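/- Let $\{0,1\}^*$ be the set of finite binary strings. For a total function $\alpha:\{0,1\}^*\to\mathbb{N}$ and a set $A\subseteq\{0,1\}^*$, let $\varepsilon_n(\alpha,A)$ be the fraction of those strings $x$ of length at most $n$ for which $\alpha(x)\ne\chi_A(x)$, where $\chi_A$ is the $0/1$-valued characteristic function of $A$, and let $\underline{E}(\alpha,A)=\liminf_{n\to\infty}\varepsilon_n(\alpha,A)$. Theorem. For every computably enumerable set $A\subseteq\{0,1\}^*$ there exists a randomized algorithm that with positive probability computes a total function $\alpha$ such that $\underline{E}(\alpha,A)=0$. That is, there exists an oracle machine $\Gamma$ such that the set of all oracles $X\in\{0,1\}^{\mathbb{N}}$ for which $\Gamma^X$ computes a total function $\alpha:\{0,1\}^*\to\mathbb{N}$ with $\underline{E}(\alpha,A)=0$ is measurable and has positive probability with respect to the uniform Bernoulli measure on $\{0,1\}^{\mathbb{N}}$ (independent fair coin tosses). -/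

import Mathlib

open Filter MeasureTheory

/-- Oracle machines, as programs in the standard (Kleene) model of relative computability: the
generators are those of `Nat.RecursiveIn`, with one instruction that queries the oracle. -/
inductive OracleMachine : Type
  | zero : OracleMachine
  | succ : OracleMachine
  | left : OracleMachine
  | right : OracleMachine
  | oracle : OracleMachine
  | pair : OracleMachine → OracleMachine → OracleMachine
  | comp : OracleMachine → OracleMachine → OracleMachine
  | prec : OracleMachine → OracleMachine → OracleMachine
  | rfind : OracleMachine → OracleMachine

/-- The partial function computed by an oracle machine when the oracle is the bit sequence `X`. -/
def OracleMachine.eval (X : ℕ → Bool) : OracleMachine → ℕ →. ℕ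
  | .zero => fun _ => Part.some 0
  | .succ => fun n => Part.some (n + 1)
  | .left => fun n => Part.some n.unpair.1
  | .right => fun n => Part.some n.unpair.2
  | .oracle => fun n => Part.some (X n).toNat
  | .pair f g => fun n => Nat.pair <$> f.eval X n <*> g.eval X n
  | .comp f g => fun n => g.eval X n >>= f.eval X
  | .prec f g => fun p =>
      let (a, n) := Nat.unpair p
      n.rec (f.eval X a) fun y IH => do
        let i ← IH
        g.eval X (Nat.pair a (Nat.pair y i))
  | .rfind f => fun a => Nat.rfind fun n => (fun m => decide (m = 0)) <$> f.eval X (Nat.pair a n)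

/-- With oracle `X`, the machine `M` computes the total function `α` on binary strings: it halts on
(the code of) every string `x` and returns `α x`. -/
def OracleMachine.Computes (M : OracleMachine) (X : ℕ → Bool) (α : List Bool → ℕ) : Prop :=
  ∀ x : List Bool, α x ∈ M.eval X (Encodable.encode x)

/-- The distribution of an infinite sequence of independent fair coin tosses on Cantor space. -/
noncomputable def coinTossing : Measure (ℕ → Bool) :=
  Measure.infinitePi fun _ : ℕ => (PMF.uniformOfFintype Bool).toMeasure

/-- The fraction of strings of length at most `n` where `α` differs from the characteristic
function of `A`. -/
noncomputable def errorRate (α : List Bool → ℕ) (A : Set (List Bool)) (n : ℕ) : ℝ :=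
  ({x : List Bool | x.length ≤ n ∧ α x ≠ A.indicator 1 x}.ncard : ℝ) /
    ({x : List Bool | x.length ≤ n}.ncard : ℝ)

/-- The lower limit of the error rates. -/
noncomputable def lowerError (α : List Bool → ℕ) (A : Set (List Bool)) : ℝ :=
  liminf (errorRate α A) atTop

/-! ### Programming oracle machines -/

/-! Errors are made one-sided: the answer on `x` is membership at some stage, so only elements of
`A` enumerated too late are missed. Let L be the limsup of the densities of `A`. If the rational q
is just below L, a length m whose enumerated fraction already exceeds q has few elements still to
come, so answering at that stage is nearly correct up to length m.

For each threshold q, coded by `e`, `scan` searches for such lengths; each find is much longer than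
the time of the previous one, so shorter strings are negligible. Waiting for every next find could
last forever, since finds may stop when q is too large. So the first `e + 2` random bits select the
indices j after which to wait: each bit pattern selects infinitely many j, and each j belongs to at
most one pattern. The number of finds has at most one final value, so threshold `e` blocks the
algorithm with probability at most 2^-(e+2) (`coinTossing_stuck_le`), and some threshold does with
probability at most 1/2.

If nothing blocks, every suitable q is waited for infinitely often, and the error there is about the
density minus q (`AnswersFrom.exists_errorRate_le`). Letting q tend to L gives lower error 0. -/

theorem OracleMachine.eval_comp_of_eq_some {X : ℕ → Bool} {f g : OracleMachine} {n m : ℕ}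
    (h : g.eval X n = Part.some m) : (comp f g).eval X n = f.eval X m := by
  change Part.bind (g.eval X n) (f.eval X) = _
  rw [h]
  exact Part.bind_some _ _

theorem OracleMachine.eval_pair_of_eq_some {X : ℕ → Bool} {f g : OracleMachine} {n a b : ℕ}
    (hf : f.eval X n = Part.some a) (hg : g.eval X n = Part.some b) :
    (pair f g).eval X n = Part.some (Nat.pair a b) := by
  simp only [eval, hf, hg, Seq.seq, Part.map_eq_map, Part.map_some, Part.bind_some]

theorem OracleMachine.exists_of_natPartrec {f : ℕ →. ℕ} (hf : Nat.Partrec f) :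
    ∃ M : OracleMachine, ∀ X, M.eval X = f := by
  induction hf with
  | zero => exact ⟨.zero, fun X => rfl⟩
  | succ => exact ⟨.succ, fun X => rfl⟩
  | left => exact ⟨.left, fun X => rfl⟩
  | right => exact ⟨.right, fun X => rfl⟩
  | pair _ _ ihf ihg =>
    obtain ⟨F, hF⟩ := ihf
    obtain ⟨G, hG⟩ := ihg
    exact ⟨.pair F G, fun X => by funext n; simp only [eval, hF, hG]⟩
  | comp _ _ ihf ihg =>
    obtain ⟨F, hF⟩ := ihf
    obtain ⟨G, hG⟩ := ihg
    exact ⟨.comp F G, fun X => by funext n; simp only [eval, hF, hG]⟩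
  | prec _ _ ihf ihg =>
    obtain ⟨F, hF⟩ := ihf
    obtain ⟨G, hG⟩ := ihg
    exact ⟨.prec F G, fun X => by funext n; simp only [eval, hF, hG, Nat.unpaired]⟩
  | rfind _ ihf =>
    obtain ⟨F, hF⟩ := ihf
    exact ⟨.rfind F, fun X => by funext n; simp only [eval, hF]⟩

theorem OracleMachine.exists_of_computable {f : ℕ → ℕ} (hf : Computable f) :
    ∃ M : OracleMachine, ∀ X n, M.eval X n = Part.some (f n) := by
  obtain ⟨M, hM⟩ := exists_of_natPartrec (Partrec.nat_iff.1 hf)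
  exact ⟨M, fun X n => by rw [hM]; rfl⟩

/-- The list of the first `n` bits of `X`. -/
def bitPrefix (X : ℕ → Bool) (n : ℕ) : List Bool := (List.range n).map X

theorem bitPrefix_take (X : ℕ → Bool) {k n : ℕ} (h : k ≤ n) :
    (bitPrefix X n).take k = bitPrefix X k := by
  rw [bitPrefix, ← List.map_take, List.take_range, min_eq_left h, bitPrefix]

theorem OracleMachine.exists_bitPrefix :
    ∃ M : OracleMachine, ∀ X n, M.eval X n = Part.some (Encodable.encode (bitPrefix X n)) := by
  -- The default `[]` is never reached: the recursion only feeds in codes of lists.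
  let step : ℕ → ℕ := fun v => Encodable.encode
    (((Encodable.decode v.unpair.1 : Option (List Bool)).getD []) ++ [decide (v.unpair.2 = 1)])
  have hstep : Primrec step := by
    refine Primrec.encode.comp (Primrec.list_concat.comp ?_ ?_)
    · exact Primrec.option_getD.comp (Primrec.decode.comp (Primrec.fst.comp Primrec.unpair))
        (Primrec.const [])
    · exact (Primrec.eq.comp (Primrec.snd.comp Primrec.unpair) (Primrec.const 1)).decide
  obtain ⟨S, hS⟩ := exists_of_computable hstep.to_comp
  obtain ⟨I, hI⟩ := exists_of_computable (f := fun n => Nat.pair 0 n)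
    (Primrec₂.natPair.comp (Primrec.const 0) Primrec.id).to_comp
  have hG : ∀ X n v, (comp S (pair (comp right right) (comp oracle (comp left right)))).eval X
      (Nat.pair 0 (Nat.pair n v)) = Part.some (step (Nat.pair v (X n).toNat)) := by
    intro X n v
    have hr : right.eval X (Nat.pair 0 (Nat.pair n v)) = Part.some (Nat.pair n v) := by
      simp only [eval, Nat.unpair_pair]
    have hl : left.eval X (Nat.pair n v) = Part.some n := by simp only [eval, Nat.unpair_pair]
    rw [eval_comp_of_eq_some (eval_pair_of_eq_some (a := v) (b := (X n).toNat) ?_ ?_), hS]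
    · rw [eval_comp_of_eq_some hr]
      simp only [eval, Nat.unpair_pair]
    · rw [eval_comp_of_eq_some ((eval_comp_of_eq_some hr).trans hl)]
      simp only [eval]
  refine ⟨.comp (.prec .zero (.comp S (.pair (.comp .right .right)
    (.comp .oracle (.comp .left .right))))) I, fun X n => ?_⟩
  rw [eval_comp_of_eq_some (hI X n), eval]
  simp only [Nat.unpair_pair]
  induction n with
  | zero => rfl
  | succ n ih =>
    change Part.bind (Nat.rec _ _ n) _ = _
    rw [ih, Part.bind_some, hG]
    simp only [step, Nat.unpair_pair, Encodable.encodek, Option.getD_some]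
    congr 2
    cases h : X n <;> simp [bitPrefix, List.range_succ, h]

/-- The number of oracle bits needed is known from the input, so they can be read in advance and an
ordinary partial recursive function does the rest. -/
theorem OracleMachine.exists_of_partrec_prefix {β : Type*} [Primcodable β]
    {H : β × List Bool →. ℕ} (hH : Partrec H) {u : β → ℕ} (hu : Primrec u) :
    ∃ M : OracleMachine, ∀ X b, M.eval X (Encodable.encode b) = H (b, bitPrefix X (u b)) := by
  obtain ⟨F, hF⟩ := exists_of_natPartrec hH
  obtain ⟨U, hU⟩ := exists_of_computable
    (f := fun v => ((Encodable.decode v : Option β).map u).getD 0)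
    (Primrec.option_getD.comp (Primrec.option_map Primrec.decode (hu.comp Primrec.snd).to₂)
      (Primrec.const 0)).to_comp
  obtain ⟨P, hP⟩ := exists_bitPrefix
  refine ⟨.comp F (.pair (.pair .left .right) (.comp P U)), fun X b => ?_⟩
  have h : Encodable.encode (b, bitPrefix X (u b)) =
      Nat.pair (Encodable.encode b) (Encodable.encode (bitPrefix X (u b))) := rfl
  have hUb : U.eval X (Encodable.encode b) = Part.some (u b) := by
    rw [hU, Encodable.encodek, Option.map_some, Option.getD_some]
  -- `pair left right` serves as the identity program.
  have hb : (pair left right).eval X (Encodable.encode b) = Part.some (Encodable.encode b) := by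
    rw [eval_pair_of_eq_some (a := (Encodable.encode b).unpair.1)
      (b := (Encodable.encode b).unpair.2) rfl rfl, Nat.pair_unpair]
  rw [eval_comp_of_eq_some (eval_pair_of_eq_some hb ((eval_comp_of_eq_some hUb).trans (hP X _))),
    ← h, hF]
  simp only [Encodable.encodek, Part.coe_some, Part.bind_some]
  exact Part.map_id' (fun _ => rfl) _

/-! ### Enumeration of short strings -/

/-- All binary strings of length at most `n`. -/
def shortStrings : ℕ → List (List Bool)
  | 0 => [[]]
  | n + 1 => [] :: ((shortStrings n).map (List.cons false) ++ (shortStrings n).map (List.cons true))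

theorem mem_shortStrings {n : ℕ} {x : List Bool} : x ∈ shortStrings n ↔ x.length ≤ n := by
  induction n generalizing x with
  | zero => simp [shortStrings]
  | succ n ih =>
    cases x with
    | nil => simp [shortStrings]
    | cons b x => cases b <;> simp [shortStrings, ih]

theorem nodup_shortStrings (n : ℕ) : (shortStrings n).Nodup := by
  induction n with
  | zero => simp [shortStrings]
  | succ n ih =>
    refine List.nodup_cons.2 ⟨by simp, List.Nodup.append (ih.map List.cons_injective)
      (ih.map List.cons_injective) ?_⟩
    intro x hx hy
    simp only [List.mem_map] at hx hy
    obtain ⟨y, -, rfl⟩ := hx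
    obtain ⟨z, -, hz⟩ := hy
    simp at hz

theorem length_shortStrings (n : ℕ) : (shortStrings n).length + 1 = 2 ^ (n + 1) := by
  induction n with
  | zero => simp [shortStrings]
  | succ n ih =>
    simp only [shortStrings, List.length_cons, List.length_append, List.length_map]
    rw [pow_succ, ← ih]
    ring

theorem ncard_short_eq (n : ℕ) (p : List Bool → Prop) [DecidablePred p] :
    {x : List Bool | x.length ≤ n ∧ p x}.ncard = ((shortStrings n).filter (p ·)).length := by
  rw [← List.toFinset_card_of_nodup ((nodup_shortStrings n).filter _), ← Set.ncard_coe_finset]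
  congr 1
  ext x
  simp [mem_shortStrings]

theorem ncard_short (n : ℕ) :
    {x : List Bool | x.length ≤ n}.ncard = (shortStrings n).length := by
  simpa using ncard_short_eq n (fun _ => True)

theorem finite_short (n : ℕ) : {x : List Bool | x.length ≤ n}.Finite :=
  (List.finite_toSet (shortStrings n)).subset fun _ hx => mem_shortStrings.2 hx

theorem primrec_shortStrings : Primrec shortStrings := by
  have h : Primrec₂ fun (_ : ℕ) (L : List (List Bool)) =>
      ([] : List Bool) :: (L.map (List.cons false) ++ L.map (List.cons true)) := by
    refine Primrec.list_cons.comp₂ (Primrec₂.const []) (Primrec.list_append.comp₂ ?_ ?_)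
    · exact Primrec.list_map Primrec.snd
        (Primrec.list_cons.comp (Primrec.const false) Primrec.snd).to₂
    · exact Primrec.list_map Primrec.snd
        (Primrec.list_cons.comp (Primrec.const true) Primrec.snd).to₂
  refine (Primrec.nat_rec₁ [[]] h).of_eq fun n => ?_
  induction n with
  | zero => rfl
  | succ n ih => simp only [shortStrings, ← ih]

/-! ### Recursively enumerable sets by stages -/

/-- Stages are step-bounded evaluations `evaln` of a code that semi-decides `A`. -/
theorem REPred.exists_stages {A : Set (List Bool)} (hA : REPred fun x => x ∈ A) :
    ∃ a : ℕ → List Bool → Bool, Primrec₂ a ∧ (∀ s t x, s ≤ t → a s x = true → a t x = true) ∧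
      ∀ x, x ∈ A ↔ ∃ s, a s x = true := by
  obtain ⟨c, hc⟩ := Nat.Partrec.Code.exists_code.1 hA
  refine ⟨fun s x => (c.evaln s (Encodable.encode x)).isSome, ?_, ?_, ?_⟩
  · exact Primrec.option_isSome.comp (Nat.Partrec.Code.primrec_evaln.comp
      (Primrec.pair (Primrec.pair Primrec.fst (Primrec.const c))
        (Primrec.encode.comp Primrec.snd)))
  · intro s t x hst h
    obtain ⟨v, hv⟩ := Option.isSome_iff_exists.1 h
    exact Option.isSome_iff_exists.2 ⟨v, Nat.Partrec.Code.evaln_mono hst hv⟩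
  · intro x
    have h : x ∈ A ↔ (c.eval (Encodable.encode x)).Dom := by
      rw [hc]
      simp [Part.assert]
    rw [h, Part.dom_iff_mem]
    constructor
    · rintro ⟨v, hv⟩
      obtain ⟨s, hs⟩ := Nat.Partrec.Code.evaln_complete.1 hv
      exact ⟨s, Option.isSome_iff_exists.2 ⟨v, hs⟩⟩
    · rintro ⟨s, hs⟩
      obtain ⟨v, hv⟩ := Option.isSome_iff_exists.1 hs
      exact ⟨v, Nat.Partrec.Code.evaln_sound hv⟩

/-! ### Scanning for lengths of high density -/

section Scan

variable (a : ℕ → List Bool → Bool)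

/-- The number of strings of length at most `m` that are enumerated by stage `s`. -/
def stageCount (s m : ℕ) : ℕ := ((shortStrings m).filter fun x => a s x = true).length

/-- Among the strings of length at most `t.unpair.1`, the fraction enumerated by stage `t` exceeds
the rational number coded by `e`. -/
def Exceeds (e t : ℕ) : Prop :=
  e.unpair.1 * (shortStrings t.unpair.1).length <
    stageCount a t t.unpair.1 * (e.unpair.2 + 1)

instance (e t : ℕ) : Decidable (Exceeds a e t) := inferInstanceAs (Decidable (_ < _))

/-- The scan for the threshold coded by `e`, run up to time `t`: the number of witnesses found and
the time of the last find. A new witness has to be much longer than the time of the previous one. -/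
def scan (e t : ℕ) : ℕ × ℕ :=
  t.rec (0, e) fun t st =>
    if st.2 + st.1 < t.unpair.1 ∧ Exceeds a e t then (st.1 + 1, t) else st

theorem scan_succ (e t : ℕ) : scan a e (t + 1) =
    if (scan a e t).2 + (scan a e t).1 < t.unpair.1 ∧ Exceeds a e t then ((scan a e t).1 + 1, t)
    else scan a e t := rfl

theorem scan_fst_mono (e : ℕ) : Monotone fun t => (scan a e t).1 := by
  refine monotone_nat_of_le_succ fun t => ?_
  rw [scan_succ]
  split_ifs <;> simp

/-- This is why the scan starts with `e` as its last find time: strings longer than that time then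
take threshold `e` into account. -/
theorem le_scan_snd (e t : ℕ) : e ≤ (scan a e t).2 := by
  induction t with
  | zero => exact le_rfl
  | succ t ih =>
    rw [scan_succ]
    split_ifs with h
    · have := Nat.unpair_left_le t
      dsimp only
      omega
    · exact ih

/-- Each find records its own time, so no find occurs from `n` up to `t`. A string can thus read off
the current state of the scan by using its length as the time. -/
theorem scan_eq_of_snd_lt {e t n : ℕ} (hn : (scan a e t).2 < n) (hnt : n ≤ t) :
    scan a e n = scan a e t := by
  induction t with
  | zero => omega
  | succ t ih =>
    rcases hnt.eq_or_lt with rfl | hlt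
    · rfl
    rw [scan_succ] at hn ⊢
    split_ifs at hn ⊢ with h
    · exact absurd hn (by dsimp only; omega)
    · exact ih hn (by omega)

/-- The oracle `X` demands to wait for the next witness after the `j`-th one. -/
def Demands (X : ℕ → Bool) (e j : ℕ) : Prop :=
  Encodable.encode (bitPrefix X (e + 2)) = j.unpair.1

theorem exists_demands (X : ℕ → Bool) (e k : ℕ) : ∃ j, k ≤ j ∧ Demands X e j :=
  ⟨Nat.pair (Encodable.encode (bitPrefix X (e + 2))) k, Nat.right_le_pair _ _,
    by simp [Demands]⟩

/-- At stage `s`, all waits demanded by the bits `l` for strings of length `n` are over. -/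
def Ready (l : List Bool) (n s : ℕ) : Prop :=
  ∀ e < n, Encodable.encode (l.take (e + 2)) = (scan a e n).1.unpair.1 →
    (scan a e n).1 < (scan a e s).1

instance (l : List Bool) (n s : ℕ) : Decidable (Ready a l n s) :=
  inferInstanceAs (Decidable (∀ e < n, _ → _))

/-- The answer on the string `p.1` when the first random bits are `p.2`. -/
def answer (p : List Bool × List Bool) : Part ℕ :=
  (Nat.rfind fun s => Part.some (decide (Ready a p.2 p.1.length s))).map fun s => (a s p.1).toNat

/-- The scan for `e` is asked to wait for a witness which does not exist. -/
def Stuck (X : ℕ → Bool) (e : ℕ) : Prop :=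
  ∃ n, Demands X e (scan a e n).1 ∧ ∀ s, (scan a e s).1 ≤ (scan a e n).1

variable {a}

theorem ready_bitPrefix {X : ℕ → Bool} {n s : ℕ} :
    Ready a (bitPrefix X (n + 2)) n s ↔
      ∀ e < n, Demands X e (scan a e n).1 → (scan a e n).1 < (scan a e s).1 := by
  refine forall₂_congr fun e he => ?_
  rw [bitPrefix_take X (by omega : e + 2 ≤ n + 2), Demands]

theorem mem_answer {p : List Bool × List Bool} {v : ℕ} (h : v ∈ answer a p) :
    ∃ s, Ready a p.2 p.1.length s ∧ v = (a s p.1).toNat := by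
  obtain ⟨s, hs, rfl⟩ := (Part.mem_map_iff _).1 h
  exact ⟨s, by simpa using Nat.rfind_spec hs, rfl⟩

theorem answer_dom {p : List Bool × List Bool} :
    (answer a p).Dom ↔ ∃ s, Ready a p.2 p.1.length s := by
  constructor
  · intro h
    obtain ⟨s, hs, -⟩ := mem_answer (Part.get_mem h)
    exact ⟨s, hs⟩
  · rintro ⟨s, hs⟩
    have : (Nat.rfind fun s => Part.some (decide (Ready a p.2 p.1.length s))).Dom :=
      Nat.rfind_dom'.2 ⟨s, by simpa using hs, fun _ => trivial⟩
    exact this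

theorem forall_answer_dom_iff {X : ℕ → Bool} :
    (∀ x : List Bool, (answer a (x, bitPrefix X (x.length + 2))).Dom) ↔ ∀ e, ¬ Stuck a X e := by
  simp only [answer_dom, ready_bitPrefix]
  constructor
  · rintro h e ⟨n, hd, hs⟩
    -- A string longer than `e` consults threshold `e`; length at least `n` ensures that the count
    -- is already final.
    obtain ⟨s, hs'⟩ := h (List.replicate (max n (e + 1)) false)
    rw [List.length_replicate] at hs'
    have heq : (scan a e (max n (e + 1))).1 = (scan a e n).1 :=
      le_antisymm (hs _) (scan_fst_mono a e (le_max_left _ _))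
    have := hs' e (by omega) (by rwa [heq])
    have := hs s
    omega
  · intro h x
    have key : ∀ e, ∃ s, Demands X e (scan a e x.length).1 →
        (scan a e x.length).1 < (scan a e s).1 := by
      intro e
      by_contra! hc
      exact h e ⟨x.length, (hc 0).1, fun s => (hc s).2⟩
    choose s hs using key
    refine ⟨(Finset.range x.length).sup s, fun e he hd => (hs e hd).trans_le ?_⟩
    exact scan_fst_mono a e (Finset.le_sup (f := s) (Finset.mem_range.2 he))

/-! ### Computability of the algorithm -/

theorem primrec_stageCount (ha : Primrec₂ a) : Primrec₂ (stageCount a) := by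
  have hR : PrimrecPred fun q : List Bool × ℕ => a q.2 q.1 = true :=
    Primrec.eq.comp (ha.comp Primrec.snd Primrec.fst) (Primrec.const true)
  have hF : Primrec₂ fun (L : List (List Bool)) (s : ℕ) => L.filter fun x => a s x = true :=
    PrimrecRel.listFilter (R := fun x s => a s x = true) hR
  exact Primrec.list_length.comp (hF.comp (primrec_shortStrings.comp Primrec.snd) Primrec.fst)

theorem primrecRel_exceeds (ha : Primrec₂ a) : PrimrecRel (Exceeds a) := by
  have hm : Primrec fun p : ℕ × ℕ => p.2.unpair.1 :=
    Primrec.fst.comp (Primrec.unpair.comp Primrec.snd)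
  have he : Primrec fun p : ℕ × ℕ => p.1.unpair := Primrec.unpair.comp Primrec.fst
  exact Primrec.nat_lt.comp
    (Primrec.nat_mul.comp (Primrec.fst.comp he)
      (Primrec.list_length.comp (primrec_shortStrings.comp hm)))
    (Primrec.nat_mul.comp ((primrec_stageCount ha).comp Primrec.snd hm)
      (Primrec.succ.comp (Primrec.snd.comp he)))

theorem primrec_scan (ha : Primrec₂ a) : Primrec₂ (scan a) := by
  have h1 : Primrec fun q : ℕ × ℕ × ℕ × ℕ => q.2.1 := Primrec.fst.comp Primrec.snd
  have h2 : Primrec fun q : ℕ × ℕ × ℕ × ℕ => q.2.2 := Primrec.snd.comp Primrec.snd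
  refine Primrec.nat_rec (f := fun e : ℕ => (0, e))
    (g := fun e q => if q.2.2 + q.2.1 < q.1.unpair.1 ∧ Exceeds a e q.1 then (q.2.1 + 1, q.1)
      else q.2) (Primrec.pair (Primrec.const 0) Primrec.id) ?_
  refine Primrec.ite (PrimrecPred.and ?_ ?_) (Primrec.pair ?_ h1) h2
  · exact Primrec.nat_lt.comp
      (Primrec.nat_add.comp (Primrec.snd.comp h2) (Primrec.fst.comp h2))
      (Primrec.fst.comp (Primrec.unpair.comp h1))
  · exact (primrecRel_exceeds ha).comp Primrec.fst h1
  · exact Primrec.succ.comp (Primrec.fst.comp h2)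

theorem primrecPred_ready (ha : Primrec₂ a) :
    PrimrecPred fun p : (List Bool × ℕ) × ℕ => Ready a p.1.1 p.1.2 p.2 := by
  have hR : PrimrecRel fun (e : ℕ) (p : (List Bool × ℕ) × ℕ) =>
      Encodable.encode (p.1.1.take (e + 2)) = (scan a e p.1.2).1.unpair.1 →
        (scan a e p.1.2).1 < (scan a e p.2).1 := by
    have hp : Primrec fun q : ℕ × (List Bool × ℕ) × ℕ => q.2 := Primrec.snd
    have hc : Primrec fun q : ℕ × (List Bool × ℕ) × ℕ => (scan a q.1 q.2.1.2).1 :=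
      Primrec.fst.comp ((primrec_scan ha).comp Primrec.fst
        (Primrec.snd.comp (Primrec.fst.comp hp)))
    have hd : PrimrecPred fun q : ℕ × (List Bool × ℕ) × ℕ =>
        Encodable.encode (q.2.1.1.take (q.1 + 2)) = (scan a q.1 q.2.1.2).1.unpair.1 :=
      Primrec.eq.comp
        (Primrec.encode.comp (Primrec.list_take.comp
          (Primrec.nat_add.comp Primrec.fst (Primrec.const 2))
          (Primrec.fst.comp (Primrec.fst.comp hp))))
        (Primrec.fst.comp (Primrec.unpair.comp hc))
    have hl : PrimrecPred fun q : ℕ × (List Bool × ℕ) × ℕ =>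
        (scan a q.1 q.2.1.2).1 < (scan a q.1 q.2.2).1 :=
      Primrec.nat_lt.comp hc (Primrec.fst.comp ((primrec_scan ha).comp Primrec.fst
        (Primrec.snd.comp hp)))
    exact (hd.not.or hl).of_eq fun q => imp_iff_not_or.symm
  have hF := PrimrecPred.comp (f := fun p : (List Bool × ℕ) × ℕ => (List.range p.1.2, p))
    hR.forall_mem_list
    (Primrec.pair (Primrec.list_range.comp (Primrec.snd.comp Primrec.fst)) Primrec.id)
  exact hF.of_eq fun p => by simp only [List.mem_range, Ready]

theorem partrec_answer (ha : Primrec₂ a) : Partrec (answer a) := by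
  have hr : Primrec₂ fun (p : List Bool × List Bool) s => decide (Ready a p.2 p.1.length s) :=
    PrimrecPred.decide ((primrecPred_ready ha).comp (Primrec.pair
      (Primrec.pair (Primrec.snd.comp Primrec.fst)
        (Primrec.list_length.comp (Primrec.fst.comp Primrec.fst))) Primrec.snd))
  have hv : Primrec₂ fun (p : List Bool × List Bool) s => (a s p.1).toNat :=
    (Primrec.dom_finite Bool.toNat).comp (ha.comp Primrec.snd (Primrec.fst.comp Primrec.fst))
  exact (Partrec.rfind hr.to_comp.partrec₂).map hv.to_comp

end Scan

/-! ### The probability of getting stuck -/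

theorem measurableSet_demands (e j : ℕ) : MeasurableSet {X : ℕ → Bool | Demands X e j} := by
  have h : Measurable fun X : ℕ → Bool => fun i : Fin (e + 2) => X i :=
    measurable_pi_lambda _ fun i => measurable_pi_apply _
  have : {X : ℕ → Bool | Demands X e j} = (fun X : ℕ → Bool => fun i : Fin (e + 2) => X i) ⁻¹'
      {v | Encodable.encode (List.ofFn v) = j.unpair.1} := by
    ext X
    simp only [Set.mem_ofPred_eq, Set.mem_preimage, Demands]
    rw [bitPrefix, List.ofFn_eq_map, ← List.map_coe_finRange_eq_range, List.map_map]
    rfl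
  rw [this]
  exact h (Set.toFinite _).measurableSet

theorem coinTossing_agree (Y : ℕ → Bool) (k : ℕ) :
    coinTossing {X | ∀ i < k, X i = Y i} = 2⁻¹ ^ k := by
  have : {X : ℕ → Bool | ∀ i < k, X i = Y i} =
      Set.pi (Finset.range k : Finset ℕ) fun i => {Y i} := by
    ext X
    simp [Set.mem_pi]
  rw [this, coinTossing, Measure.infinitePi_pi _ (fun i _ => measurableSet_singleton _)]
  simp

/-- Oracles that demand the same `j` share their first `e + 2` bits, so they lie in one cylinder. -/
theorem coinTossing_demands_le (e j : ℕ) :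
    coinTossing {X | Demands X e j} ≤ 2⁻¹ ^ (e + 2) := by
  rcases Set.eq_empty_or_nonempty {X | Demands X e j} with h | ⟨Y, hY⟩
  · simp [h]
  · rw [← coinTossing_agree Y (e + 2)]
    refine measure_mono fun X hX i hi => ?_
    have h : bitPrefix X (e + 2) = bitPrefix Y (e + 2) :=
      Encodable.encode_injective (Eq.trans hX (Eq.symm hY))
    exact List.map_inj_left.1 h i (List.mem_range.2 hi)

theorem measurableSet_stuck (a : ℕ → List Bool → Bool) (e : ℕ) :
    MeasurableSet {X | Stuck a X e} := by
  have : {X | Stuck a X e} =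
      ⋃ n, {X | Demands X e (scan a e n).1} ∩ {_X | ∀ s, (scan a e s).1 ≤ (scan a e n).1} := by
    ext X
    simp [Stuck]
  rw [this]
  exact .iUnion fun n => (measurableSet_demands _ _).inter (.const _)

/-- The only dangerous index is the final value of the count, which does not depend on `X`; if the
count is unbounded, there is none. -/
theorem coinTossing_stuck_le (a : ℕ → List Bool → Bool) (e : ℕ) :
    coinTossing {X | Stuck a X e} ≤ 2⁻¹ ^ (e + 2) := by
  by_cases h : ∃ n, ∀ s, (scan a e s).1 ≤ (scan a e n).1
  · obtain ⟨n, hn⟩ := h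
    refine (measure_mono ?_).trans (coinTossing_demands_le e (scan a e n).1)
    rintro X ⟨m, hd, hm⟩
    rwa [le_antisymm (hn m) (hm n)] at hd
  · have : {X | Stuck a X e} = ∅ :=
      Set.eq_empty_iff_forall_notMem.2 fun X ⟨n, _, hn⟩ => h ⟨n, hn⟩
    simp [this]

instance : IsProbabilityMeasure coinTossing := by
  unfold coinTossing
  infer_instance

theorem coinTossing_never_stuck_pos (a : ℕ → List Bool → Bool) :
    0 < coinTossing {X | ∀ e, ¬ Stuck a X e} := by
  have hc : {X | ∀ e, ¬ Stuck a X e} = (⋃ e, {X | Stuck a X e})ᶜ := by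
    ext X
    simp
  have hle : coinTossing (⋃ e, {X | Stuck a X e}) ≤ 2⁻¹ := by
    calc coinTossing (⋃ e, {X | Stuck a X e}) ≤ ∑' e, coinTossing {X | Stuck a X e} :=
          measure_iUnion_le _
      _ ≤ ∑' e : ℕ, 2⁻¹ ^ (e + 2) := ENNReal.tsum_le_tsum (coinTossing_stuck_le a)
      _ = 2⁻¹ := by
          simp_rw [pow_add]
          rw [ENNReal.tsum_mul_right, ENNReal.tsum_geometric_two, pow_two, ← mul_assoc,
            ENNReal.mul_inv_cancel two_ne_zero ENNReal.ofNat_ne_top, one_mul]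
  rw [hc, prob_compl_eq_one_sub (.iUnion fun e => measurableSet_stuck a e)]
  exact tsub_pos_of_lt (hle.trans_lt ENNReal.one_half_lt_one)

theorem measurableSet_never_stuck (a : ℕ → List Bool → Bool) :
    MeasurableSet {X | ∀ e, ¬ Stuck a X e} := by
  simp only [Set.ofPred_forall]
  exact .iInter fun e => (measurableSet_stuck a e).compl

/-! ### The error of the algorithm -/

/-- The fraction of elements of `A` among the strings of length at most `n`. -/
noncomputable def density (A : Set (List Bool)) (n : ℕ) : ℝ :=
  ({x : List Bool | x.length ≤ n ∧ x ∈ A}.ncard : ℝ) / ({x : List Bool | x.length ≤ n}.ncard : ℝ)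

theorem finite_short_and (n : ℕ) (p : List Bool → Prop) :
    {x : List Bool | x.length ≤ n ∧ p x}.Finite :=
  (finite_short n).subset fun _ hx => hx.1

theorem ncard_short_and_le (n : ℕ) (p : List Bool → Prop) :
    {x : List Bool | x.length ≤ n ∧ p x}.ncard ≤ {x : List Bool | x.length ≤ n}.ncard :=
  Set.ncard_le_ncard (fun _ hx => hx.1) (finite_short n)

theorem ncard_short_add_one (n : ℕ) : {x : List Bool | x.length ≤ n}.ncard + 1 = 2 ^ (n + 1) := by
  rw [ncard_short, length_shortStrings]

theorem ncard_short_pos (n : ℕ) : 0 < {x : List Bool | x.length ≤ n}.ncard := by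
  have := ncard_short_add_one n
  have := Nat.one_lt_two_pow (n := n + 1) (by omega)
  omega

theorem ncard_short_mul_le {l j n : ℕ} (h : l + j < n) :
    {x : List Bool | x.length ≤ l}.ncard * 2 ^ j ≤ {x : List Bool | x.length ≤ n}.ncard := by
  have h1 := ncard_short_add_one l
  have h2 := ncard_short_add_one n
  have h3 : 2 ^ (l + 1) * 2 ^ j ≤ 2 ^ n := by
    rw [← pow_add]
    exact Nat.pow_le_pow_right two_pos (by omega)
  have h4 : {x : List Bool | x.length ≤ l}.ncard * 2 ^ j ≤ 2 ^ (l + 1) * 2 ^ j :=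
    Nat.mul_le_mul_right _ (by omega)
  have h5 := Nat.one_le_two_pow (n := n)
  rw [pow_succ] at h2
  omega

theorem density_nonneg (A : Set (List Bool)) (n : ℕ) : 0 ≤ density A n := by
  unfold density
  positivity

theorem density_le_one (A : Set (List Bool)) (n : ℕ) : density A n ≤ 1 :=
  div_le_one_of_le₀ (by exact_mod_cast ncard_short_and_le n _) (by positivity)

theorem errorRate_nonneg (α : List Bool → ℕ) (A : Set (List Bool)) (n : ℕ) :
    0 ≤ errorRate α A n := by
  unfold errorRate
  positivity

theorem errorRate_le_one (α : List Bool → ℕ) (A : Set (List Bool)) (n : ℕ) :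
    errorRate α A n ≤ 1 :=
  div_le_one_of_le₀ (by exact_mod_cast ncard_short_and_le n _) (by positivity)

section

variable {A : Set (List Bool)} {a : ℕ → List Bool → Bool}

theorem stageCount_eq_ncard (s m : ℕ) :
    stageCount a s m = {x : List Bool | x.length ≤ m ∧ a s x = true}.ncard :=
  (ncard_short_eq m _).symm

theorem exists_stage (haA : ∀ x, x ∈ A ↔ ∃ s, a s x = true)
    (hmono : ∀ s t x, s ≤ t → a s x = true → a t x = true) (m : ℕ) :
    ∃ s₀, ∀ s ≥ s₀, stageCount a s m = {x : List Bool | x.length ≤ m ∧ x ∈ A}.ncard := by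
  have h : ∀ x, ∃ s, x ∈ A → a s x = true := by
    intro x
    by_cases hx : x ∈ A
    · obtain ⟨s, hs⟩ := (haA x).1 hx
      exact ⟨s, fun _ => hs⟩
    · exact ⟨0, fun h => absurd h hx⟩
  choose f hf using h
  refine ⟨(shortStrings m).toFinset.sup f, fun s hs => ?_⟩
  rw [stageCount_eq_ncard]
  congr 1
  ext x
  refine and_congr_right fun hx => ⟨fun h => (haA x).2 ⟨s, h⟩, fun h => ?_⟩
  refine hmono (f x) s x (le_trans ?_ hs) (hf x h)
  exact Finset.le_sup (f := f) (List.mem_toFinset.2 (mem_shortStrings.2 hx))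

/-- Otherwise the scan is frozen after `t`. A long `m` of density above the threshold, paired with a
stage by which all its elements of `A` have appeared, would be a further find. -/
theorem exists_scan_lt (haA : ∀ x, x ∈ A ↔ ∃ s, a s x = true)
    (hmono : ∀ s t x, s ≤ t → a s x = true → a t x = true) {p r : ℕ}
    (hfreq : ∃ᶠ m in atTop, (p : ℝ) / (r + 1) < density A m) (t : ℕ) :
    ∃ t', (scan a (Nat.pair p r) t).1 < (scan a (Nat.pair p r) t').1 := by
  by_contra! hc
  set e := Nat.pair p r with he
  have hstep : ∀ u ≥ t, ¬ ((scan a e u).2 + (scan a e u).1 < u.unpair.1 ∧ Exceeds a e u) := by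
    intro u hu hu'
    have h1 := hc (u + 1)
    have h2 : (scan a e t).1 ≤ (scan a e u).1 := scan_fst_mono a e hu
    rw [scan_succ, if_pos hu'] at h1
    dsimp only at h1
    omega
  have hconst : ∀ u ≥ t, scan a e u = scan a e t := by
    intro u hu
    induction u, hu using Nat.le_induction with
    | base => rfl
    | succ u hu ih => rw [scan_succ, if_neg (hstep u hu), ih]
  obtain ⟨m, hm, hd⟩ := frequently_atTop.1 hfreq (max t ((scan a e t).2 + (scan a e t).1 + 1))
  obtain ⟨s₀, hs₀⟩ := exists_stage haA hmono m
  have hle1 : m ≤ Nat.pair m s₀ := Nat.left_le_pair m s₀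
  have hle2 : s₀ ≤ Nat.pair m s₀ := Nat.right_le_pair m s₀
  refine hstep (Nat.pair m s₀) (by omega) ⟨?_, ?_⟩
  · rw [hconst _ (by omega), Nat.unpair_pair]
    dsimp only
    omega
  · unfold Exceeds
    simp only [he, Nat.unpair_pair]
    rw [hs₀ _ hle2, ← ncard_short]
    have hT : (0 : ℝ) < {x : List Bool | x.length ≤ m}.ncard := by
      exact_mod_cast ncard_short_pos m
    rw [density, div_lt_div_iff₀ (by positivity) hT] at hd
    exact_mod_cast hd

theorem exists_find (e : ℕ) (h : ∀ t, ∃ t', (scan a e t).1 < (scan a e t').1) (j : ℕ) :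
    ∃ t, (scan a e t).1 = j ∧ (scan a e t).2 + j < t.unpair.1 ∧ Exceeds a e t := by
  have hj : ∀ j, ∃ t, j < (scan a e t).1 := by
    intro j
    induction j with
    | zero =>
      obtain ⟨t, ht⟩ := h 0
      exact ⟨t, by omega⟩
    | succ j ih =>
      obtain ⟨t, ht⟩ := ih
      obtain ⟨t', ht'⟩ := h t
      exact ⟨t', by omega⟩
  classical
  -- The count rises by one at a time, so the find sought occurs just before the first time it
  -- exceeds `j`.
  have hspec := Nat.find_spec (hj j)
  have hmin := fun m => Nat.find_min (hj j) (m := m)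
  rcases hf : Nat.find (hj j) with _ | t
  · rw [hf] at hspec
    exact absurd hspec (Nat.not_lt_zero _)
  · rw [hf] at hspec hmin
    have hlt := hmin t (Nat.lt_succ_self t)
    rw [scan_succ] at hspec
    split_ifs at hspec with hc
    · have heq : (scan a e t).1 = j := by
        dsimp only at hspec
        omega
      rw [heq] at hc
      exact ⟨t, heq, hc⟩
    · exact absurd hspec hlt

/-- The values `α` are computed from the stages at which the oracle `X` no longer asks to wait. -/
def AnswersFrom (a : ℕ → List Bool → Bool) (X : ℕ → Bool) (α : List Bool → ℕ) : Prop :=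
  ∀ x, ∃ s, Ready a (bitPrefix X (x.length + 2)) x.length s ∧ α x = (a s x).toNat

theorem AnswersFrom.error_mem {X : ℕ → Bool} {α : List Bool → ℕ} (hα : AnswersFrom a X α)
    (haA : ∀ x, x ∈ A ↔ ∃ s, a s x = true) {x : List Bool} (hx : α x ≠ A.indicator 1 x) :
    x ∈ A ∧ ∃ s, Ready a (bitPrefix X (x.length + 2)) x.length s ∧ a s x = false := by
  obtain ⟨s, hs, hv⟩ := hα x
  rcases Bool.eq_false_or_eq_true (a s x) with h | h
  · refine absurd ?_ hx
    rw [hv, h, Set.indicator_of_mem ((haA x).2 ⟨s, h⟩)]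
    rfl
  · refine ⟨?_, s, hs, h⟩
    by_contra hA
    refine hx ?_
    rw [hv, h, Set.indicator_of_notMem hA]
    rfl

theorem AnswersFrom.errorRate_le_density {X : ℕ → Bool} {α : List Bool → ℕ}
    (hα : AnswersFrom a X α) (haA : ∀ x, x ∈ A ↔ ∃ s, a s x = true) (n : ℕ) :
    errorRate α A n ≤ density A n := by
  refine div_le_div_of_nonneg_right (Nat.cast_le.2 (Set.ncard_le_ncard ?_ (finite_short_and n _)))
    (by positivity)
  exact fun x hx => ⟨hx.1, (hα.error_mem haA hx.2).1⟩

/-- Choose a demanded `j ≥ K` and let `t` be the find that raises the count from `j`, with length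
`n`. Strings longer than the previous find time `l` and of length at most `n` wait past `t`, so they
miss only what appears after stage `t`. The rest are at most a 2^-j fraction. -/
theorem AnswersFrom.exists_errorRate_le {X : ℕ → Bool} {α : List Bool → ℕ}
    (hα : AnswersFrom a X α) (haA : ∀ x, x ∈ A ↔ ∃ s, a s x = true)
    (hmono : ∀ s t x, s ≤ t → a s x = true → a t x = true) {p r : ℕ}
    (hfreq : ∃ᶠ m in atTop, (p : ℝ) / (r + 1) < density A m) (K : ℕ) :
    ∃ n ≥ K, errorRate α A n ≤ density A n - p / (r + 1) + (1 / 2) ^ K := by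
  set e := Nat.pair p r with he
  obtain ⟨j, hKj, hdem⟩ := exists_demands X e K
  obtain ⟨t, htj, hlt, hex⟩ := exists_find e (exists_scan_lt haA hmono hfreq) j
  set n := t.unpair.1 with hn
  set l := (scan a e t).2 with hl
  have hnt : n ≤ t := Nat.unpair_left_le t
  have hel : e ≤ l := le_scan_snd a e t
  refine ⟨n, by omega, ?_⟩
  have hsub : {x : List Bool | x.length ≤ n ∧ α x ≠ A.indicator 1 x} ⊆
      {x | x.length ≤ l} ∪ ({x | x.length ≤ n ∧ x ∈ A} \ {x | x.length ≤ n ∧ a t x = true}) := by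
    rintro x ⟨hxn, hx⟩
    obtain ⟨hxA, s, hs, hsx⟩ := hα.error_mem haA hx
    by_cases hxl : x.length ≤ l
    · exact Or.inl hxl
    · refine Or.inr ⟨⟨hxn, hxA⟩, fun hxt => ?_⟩
      push Not at hxl
      have hsc : scan a e x.length = scan a e t := scan_eq_of_snd_lt a hxl (hxn.trans hnt)
      have hready := ready_bitPrefix.1 hs e (by omega) (by rwa [hsc, htj])
      rw [hsc] at hready
      -- At times up to `t` the count is at most `j`, while readiness requires more.
      have hts : t ≤ s := by
        by_contra! hst
        exact absurd (scan_fst_mono a e hst.le) (not_le.2 hready)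
      rw [hmono t s x hts hxt.2] at hsx
      exact Bool.noConfusion hsx
  have hcard : {x : List Bool | x.length ≤ n ∧ α x ≠ A.indicator 1 x}.ncard + stageCount a t n ≤
      {x : List Bool | x.length ≤ l}.ncard + {x : List Bool | x.length ≤ n ∧ x ∈ A}.ncard := by
    have h1 := Set.ncard_le_ncard hsub
      ((finite_short l).union ((finite_short_and n _).subset Set.sdiff_subset))
    have h2 := Set.ncard_union_le {x : List Bool | x.length ≤ l}
      ({x | x.length ≤ n ∧ x ∈ A} \ {x | x.length ≤ n ∧ a t x = true})
    have h3 := Set.ncard_sdiff_add_ncard_of_subset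
      (show {x : List Bool | x.length ≤ n ∧ a t x = true} ⊆ {x | x.length ≤ n ∧ x ∈ A} from
        fun x hx => ⟨hx.1, (haA x).2 ⟨t, hx.2⟩⟩) (finite_short_and n _)
    rw [stageCount_eq_ncard]
    omega
  have hT : (0 : ℝ) < {x : List Bool | x.length ≤ n}.ncard := by exact_mod_cast ncard_short_pos n
  have hshort : ({x : List Bool | x.length ≤ l}.ncard : ℝ) / {x : List Bool | x.length ≤ n}.ncard ≤
      (1 / 2) ^ K := by
    refine le_trans ?_ (pow_le_pow_of_le_one (by norm_num) (by norm_num) hKj)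
    rw [div_le_iff₀ hT, one_div, inv_pow, inv_mul_eq_div, le_div_iff₀ (by positivity)]
    exact_mod_cast ncard_short_mul_le hlt
  have hstage : (p : ℝ) / (r + 1) ≤ (stageCount a t n : ℝ) /
      {x : List Bool | x.length ≤ n}.ncard := by
    rw [div_le_div_iff₀ (by positivity) hT]
    unfold Exceeds at hex
    rw [← ncard_short, he, Nat.unpair_pair] at hex
    exact_mod_cast hex.le
  have hcard' : errorRate α A n + (stageCount a t n : ℝ) / {x : List Bool | x.length ≤ n}.ncard ≤
      ({x : List Bool | x.length ≤ l}.ncard : ℝ) / {x : List Bool | x.length ≤ n}.ncard +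
        density A n := by
    rw [errorRate, density, ← add_div, ← add_div]
    exact div_le_div_of_nonneg_right (by exact_mod_cast hcard) hT.le
  linarith

/-- If the limsup `L` of the densities is below `ε`, one-sidedness suffices. Otherwise three errors
of `ε / 3` add up: from the threshold to `L`, from `L` to the density, and the short strings. -/
theorem AnswersFrom.frequently_errorRate_le {X : ℕ → Bool} {α : List Bool → ℕ}
    (hα : AnswersFrom a X α) (haA : ∀ x, x ∈ A ↔ ∃ s, a s x = true)
    (hmono : ∀ s t x, s ≤ t → a s x = true → a t x = true) {ε : ℝ} (hε : 0 < ε) :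
    ∃ᶠ n in atTop, errorRate α A n ≤ ε := by
  have hbdd : IsBoundedUnder (· ≤ ·) atTop (density A) :=
    isBoundedUnder_of ⟨1, density_le_one A⟩
  have hcob : IsCoboundedUnder (· ≤ ·) atTop (density A) :=
    IsBoundedUnder.isCoboundedUnder_le (isBoundedUnder_of ⟨0, density_nonneg A⟩)
  set L := limsup (density A) atTop with hL
  rcases lt_or_ge L ε with hLε | hLε
  · exact ((eventually_lt_of_limsup_lt hLε hbdd).mono fun n hn =>
      (hα.errorRate_le_density haA n).trans hn.le).frequently
  · obtain ⟨q, hq1, hq2⟩ := exists_rat_btwn (show L - ε / 3 < L by linarith)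
    have hq0 : 0 < q := by
      have : (0 : ℝ) < q := by linarith
      exact_mod_cast this
    -- Thresholds have the form `p / (r + 1)`, hence `q.den - 1`.
    have hqpr : (q.num.toNat : ℝ) / ((q.den - 1 : ℕ) + 1) = q := by
      have h1 : ((q.den - 1 : ℕ) : ℝ) + 1 = q.den := by
        exact_mod_cast Nat.sub_add_cancel q.pos
      have h2 : ((q.num.toNat : ℕ) : ℝ) = (q.num : ℝ) := by
        exact_mod_cast Int.toNat_of_nonneg (Rat.num_pos.2 hq0).le
      rw [h1, h2]
      exact (Rat.cast_def q).symm
    have hfreq := frequently_lt_of_lt_limsup hcob hq2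
    rw [← hqpr] at hfreq
    obtain ⟨K₀, hK₀⟩ := eventually_atTop.1
      (eventually_lt_of_limsup_lt (show L < L + ε / 3 by linarith) hbdd)
    obtain ⟨K₁, hK₁⟩ := exists_pow_lt_of_lt_one (show (0 : ℝ) < ε / 3 by linarith)
      (show (1 / 2 : ℝ) < 1 by norm_num)
    refine frequently_atTop.2 fun K => ?_
    obtain ⟨n, hn, herr⟩ := hα.exists_errorRate_le haA hmono hfreq (max K (max K₀ K₁))
    refine ⟨n, by omega, ?_⟩
    have h1 := hK₀ n (by omega)
    have h2 : (1 / 2 : ℝ) ^ max K (max K₀ K₁) ≤ (1 / 2) ^ K₁ :=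
      pow_le_pow_of_le_one (by norm_num) (by norm_num) (by omega)
    rw [hqpr] at herr
    linarith

theorem AnswersFrom.lowerError_eq_zero {X : ℕ → Bool} {α : List Bool → ℕ}
    (hα : AnswersFrom a X α) (haA : ∀ x, x ∈ A ↔ ∃ s, a s x = true)
    (hmono : ∀ s t x, s ≤ t → a s x = true → a t x = true) : lowerError α A = 0 := by
  have hbelow : IsBoundedUnder (· ≥ ·) atTop (errorRate α A) :=
    isBoundedUnder_of ⟨0, errorRate_nonneg α A⟩
  have habove : IsBoundedUnder (· ≤ ·) atTop (errorRate α A) :=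
    isBoundedUnder_of ⟨1, errorRate_le_one α A⟩
  refine le_antisymm (le_of_forall_pos_le_add fun ε hε => ?_) ?_
  · rw [zero_add]
    exact liminf_le_of_frequently_le (hα.frequently_errorRate_le haA hmono hε) hbelow
  · exact le_liminf_of_le habove.isCoboundedUnder_ge (.of_forall (errorRate_nonneg α A))

end

theorem mainTheorem7 (A : Set (List Bool)) (hA : REPred fun x : List Bool => x ∈ A) :
    ∃ M : OracleMachine,
      MeasurableSet {X : ℕ → Bool | ∃ α : List Bool → ℕ, M.Computes X α ∧ lowerError α A = 0} ∧
      0 < coinTossing {X : ℕ → Bool | ∃ α : List Bool → ℕ, M.Computes X α ∧ lowerError α A = 0} := by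
  obtain ⟨a, ha, hmono, haA⟩ := hA.exists_stages
  obtain ⟨M, hM⟩ := OracleMachine.exists_of_partrec_prefix (partrec_answer ha)
    (Primrec.nat_add.comp Primrec.list_length (Primrec.const 2))
  -- Totality alone already forces lower error 0, so the event is exactly that no threshold is
  -- stuck, which is also what makes it measurable.
  have hset : {X : ℕ → Bool | ∃ α : List Bool → ℕ, M.Computes X α ∧ lowerError α A = 0} =
      {X | ∀ e, ¬ Stuck a X e} := by
    ext X
    simp only [Set.mem_ofPred_eq]
    rw [← forall_answer_dom_iff]
    constructor
    · rintro ⟨α, hα, -⟩ x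
      have := hα x
      rw [hM] at this
      exact Part.dom_iff_mem.2 ⟨_, this⟩
    · intro h
      refine ⟨fun x => (answer a (x, bitPrefix X (x.length + 2))).get (h x), fun x => ?_, ?_⟩
      · rw [hM]
        exact Part.get_mem (h x)
      · exact AnswersFrom.lowerError_eq_zero (fun x => mem_answer (Part.get_mem (h x))) haA hmono
  refine ⟨M, ?_⟩
  rw [hset]
  exact ⟨measurableSet_never_stuck a, coinTossing_never_stuck_pos a⟩
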